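/- Let $\hat G$ be a category and let $G\subset\hat G$ be a monoid, i.e. a sub-category with a single object. Compositions are written in path order: $fg$ is defined when the target of $f$ is the source of $g$. Let $X$ be a $\delta$-hyperbolic geodesic metric space (for instance a $\delta$-hyperbolic complex; $X$ need not be proper) with a base point $P$, on which $\hat G$ acts on the left by isometries: every arrow of $\hat G$ acts as a distance-preserving map $X\to X$, identities act trivially, and $(fg).x=f.(g.x)$ whenever $fg$ is defined. Let $\mathcal S$ be a finite set of arrows of $\hat G$. *Automata.* Consider a deterministic finite state automaton over $\mathcal S$: a finite set of states with exactly one exiting edge for each state and each letter of $\mathcal S$, a start state which is not the target of any edge, a fail state which is not an accept state and all of whose exiting edges loop back to it, and a set of accept states. The *accessible states* are the non-fail states which can be reached from every non-fail state; with the edges connecting them they form the *accessible sub-automaton*. The automaton is *dominated* by its accessible sub-automaton if the latter is non-empty and recurrent (for some $l\ge 1$ there is a path of length exactly $l$ from each accessible state to each accessible state), and if the exponential growth rate $\limsup_n\frac1n\log a_n$ (where $\log 0=-\infty$) of the number $a_n$ of words of length $n$ which can be read along paths in the accessible sub-automaton is strictly larger than that of the number of words which can be read, from the start state, in the automaton with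 the accessible sub-automaton and the fail state removed. *Automatic normal form hypothesis.* Every $g\in G$ has a preferred word over $\mathcal S$ representing it, its *normal form*; the language of normal forms is exactly the language accepted by such an automaton; this automaton is dominated by its accessible sub-automaton; and there is a word $w_{\rm rigid}$ such that the paths traced out from the start state by $w_{\rm rigid}$ and by $w_{\rm rigid}^2$ end in the same accept state, which is accessible. *Geodesic words hypothesis.* There is a constant $R\ge 0$ such that for every normal form word $x_1x_2\cdots x_m$ and all $0\le i<j\le m$, the points $x_1\cdots x_k.P$ with $i\le k\le j$ all lie in the $R$-neighbourhood of every geodesic connecting $x_1\cdots x_i.P$ and $x_1\cdots x_j.P$. An arrow (in particular an element of $G$) acting on $X$ as $\phi$ acts *loxodromically* if $\lim_{n\to\infty}\frac1n d_X(P,\phi^n(P))$ exists and is positive. There are *interesting loxodromic actions* if there is a loop in the accessible sub-automaton such that the product of the letters read along this loop acts loxodromically on $X$. An element of $G$ with normal form $w$ is *rigid* if the word $w^n$ is accepted by the automaton for all $n\ge 1$. Let $B(l)$ be the set of elements of $G$ whose normal form has length at most $l$. **Theorem.** Suppose that the automatic normal form hypothesis and the geodesic words hypothesis are satisfied, and that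 there are interesting loxodromic actions. Then $$\liminf_{l\to\infty}\frac{\#\{g\in B(l): g\text{ is rigid and acts loxodromically on }X\}}{\#B(l)}>0.$$ -/

import Mathlib

open CategoryTheory Filter

universe u v w

namespace NormalForms

/-! ### Words in the arrows of a category and left actions of categories -/

section Words

variable {C : Type u} [Category.{v} C]

/-- `IsProduct x f`: the word `x = x₁ x₂ ⋯ xₖ` of arrows is composable (the target of each letter is
the source of the next one) and its product, read in path order, is the arrow `f`. -/
inductive IsProduct : List (Arrow C) → ∀ {a b : C}, (a ⟶ b) → Prop
  | nil (a : C) : IsProduct [] (𝟙 a)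
  | cons {a b c : C} (f : a ⟶ b) (g : b ⟶ c) (x : List (Arrow C)) :
      IsProduct x g → IsProduct (Arrow.mk f :: x) (f ≫ g)

variable (C) in
/-- A left action of the category `C` by isometries on a metric space `X`: every arrow acts as a
distance-preserving self-map of `X`, identities act trivially, and `(fg).x = f.(g.x)`, where `fg`
is the path-order composite (first `f`, then `g`). -/
structure IsometricAction (X : Type w) [MetricSpace X] where
  act : ∀ {a b : C}, (a ⟶ b) → X → X
  act_id : ∀ (a : C) (x : X), act (𝟙 a) x = x
  act_comp : ∀ {a b c : C} (f : a ⟶ b) (g : b ⟶ c) (x : X), act (f ≫ g) x = act f (act g x)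
  isometry : ∀ {a b : C} (f : a ⟶ b), Isometry (act f)

/-- `x₁ x₂ ⋯ xₖ . p = x₁.(x₂.(⋯ (xₖ.p)))`. -/
def IsometricAction.actWord {X : Type w} [MetricSpace X] (A : IsometricAction C X) :
    List (Arrow C) → X → X
  | [], p => p
  | f :: x, p => A.act f.hom (A.actWord x p)

theorem IsometricAction.act_eq_actWord {X : Type w} [MetricSpace X] (A : IsometricAction C X)
    {x : List (Arrow C)} {a b : C} {f : a ⟶ b} (h : IsProduct x f) (p : X) :
    A.act f p = A.actWord x p := by
  induction h with
  | nil a => exact A.act_id a p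
  | cons f g x _ ih => rw [A.act_comp, ih]; rfl

end Words

/-! ### Hyperbolic geometry -/

section Geometry

variable {X : Type w} [MetricSpace X]

/-- `σ` is (the image of) a geodesic connecting `x` and `y`. -/
def IsGeodesicSegment (σ : Set X) (x y : X) : Prop :=
  ∃ γ : ℝ → X, γ 0 = x ∧ γ (dist x y) = y ∧
    (∀ s ∈ Set.Icc 0 (dist x y), ∀ t ∈ Set.Icc 0 (dist x y), dist (γ s) (γ t) = |s - t|) ∧
    σ = γ '' Set.Icc 0 (dist x y)

variable (X) in
/-- Any two points are connected by a geodesic, and every geodesic triangle is `δ`-slim. -/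
def IsHyperbolicGeodesicSpace (δ : ℝ) : Prop :=
  (∀ x y : X, ∃ σ : Set X, IsGeodesicSegment σ x y) ∧
  ∀ (x y z : X) (σ₁ σ₂ σ₃ : Set X), IsGeodesicSegment σ₁ x y → IsGeodesicSegment σ₂ y z →
    IsGeodesicSegment σ₃ x z → ∀ p ∈ σ₁, ∃ q ∈ σ₂ ∪ σ₃, dist p q ≤ δ

/-- The self-map `φ` acts loxodromically: `d(P, φⁿ P) / n` converges to a positive limit. -/
def IsLoxodromic (P : X) (φ : X → X) : Prop :=
  ∃ τ : ℝ, 0 < τ ∧ Tendsto (fun n : ℕ => dist P (φ^[n] P) / n) atTop (nhds τ)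

end Geometry

/-! ### Automata -/

section Automata

variable {α : Type u} {Q : Type v}

/-- The conventions for automata: no arrow ends in the start state; all arrows leaving the fail
state loop back to it; the fail state is not an accept state. -/
structure IsFSA (M : DFA α Q) (fail : Q) : Prop where
  step_ne_start : ∀ (s : Q) (a : α), M.step s a ≠ M.start
  step_fail : ∀ a : α, M.step fail a = fail
  fail_notMem_accept : fail ∉ M.accept

/-- The accessible states: the non-fail states which can be reached from all non-fail states. -/
def accessible (M : DFA α Q) (fail : Q) : Set Q :=
  {s | s ≠ fail ∧ ∀ t, t ≠ fail → ∃ x : List α, M.evalFrom t x = s}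

/-- The words of length `n` that can be read along a path which starts in a state of `I` and all
of whose states belong to `T`. -/
def readable (M : DFA α Q) (I T : Set Q) (n : ℕ) : Set (List α) :=
  {x | x.length = n ∧ ∃ s ∈ I, ∀ y, y <+: x → M.evalFrom s y ∈ T}

/-- The exponential growth rate of the number of words in `readable M I T n`, on a logarithmic
scale: the upper limit of `(log #(readable M I T n)) / n`, in `[-∞, ∞]`. -/
noncomputable def growthRate (M : DFA α Q) (I T : Set Q) : EReal :=
  ExpGrowth.expGrowthSup fun n => ((readable M I T n).encard : ENNReal)

/-- For some `l ≥ 1` there is, between any two states of `T`, a path of length exactly `l`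
with all states in `T`. -/
def IsRecurrentOn (M : DFA α Q) (T : Set Q) : Prop :=
  ∃ l : ℕ, 0 < l ∧ ∀ s ∈ T, ∀ t ∈ T, ∃ x : List α, x.length = l ∧
    (∀ y, y <+: x → M.evalFrom s y ∈ T) ∧ M.evalFrom s x = t

/-- The automaton is dominated by its accessible sub-automaton: the latter is non-empty and
recurrent, and the number of words readable in it has a strictly larger exponential growth rate
than the number of words which can be read, from the start state, in the automaton with the
accessible sub-automaton and the fail state removed. -/
structure IsDominated (M : DFA α Q) (fail : Q) : Prop where
  nonempty : (accessible M fail).Nonempty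
  recurrent : IsRecurrentOn M (accessible M fail)
  growth : growthRate M {M.start} {s | s ≠ fail ∧ s ∉ accessible M fail} <
    growthRate M (accessible M fail) (accessible M fail)

/-- The word `x` is rigid: `xⁿ` is accepted for all positive integers `n`. -/
def IsRigidWord (M : DFA α Q) (x : List α) : Prop :=
  ∀ n : ℕ, 0 < n → (List.replicate n x).flatten ∈ M.accepts

end Automata

/-! ### The hypotheses of the theorem -/

section Hypotheses

variable {C : Type u} [Category.{v} C] {S : Finset (Arrow C)} {Q : Type w}

/-- The word in the arrows of `C` underlying a word over the alphabet `S`. -/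
def toArrows (x : List S) : List (Arrow C) := x.map Subtype.val

/-- An element of a monoid of endomorphisms of `b`, regarded as an arrow from `b` to `b`. -/
def toHom {b : C} {G : Submonoid (End b)} (g : G) : b ⟶ b := g.1

/-- The automatic normal form hypothesis, for a monoid `G` of endomorphisms of one object of the
category, with normal forms `nf` over the finite set `S` of arrows: `nf g` represents `g`, and the
language of all normal forms is recognized by the automaton `M`, which is dominated by its
accessible sub-automaton and has a word `x` such that the paths of `x` and `x²` end in the same
accept state, which is accessible. (As a set of arrows, a submonoid of `End b` is the same thing
as a sub-category with the single object `b`.) -/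
structure AutomaticNormalForm {b : C} (G : Submonoid (End b)) (nf : G → List S)
    (M : DFA S Q) (fail : Q) : Prop where
  represents : ∀ g : G, IsProduct (toArrows (nf g)) (toHom g)
  fsa : IsFSA M fail
  recognized : ∀ x : List S, x ∈ M.accepts ↔ ∃ g : G, nf g = x
  dominated : IsDominated M fail
  exists_rigid : ∃ (x : List S) (E : Q), E ∈ M.accept ∧ E ∈ accessible M fail ∧
    M.eval x = E ∧ M.eval (x ++ x) = E

variable {X : Type*} [MetricSpace X]

/-- The geodesic words hypothesis: for some `R ≥ 0`, for every accepted word `x₁ x₂ ⋯ xₘ` and all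
`0 ≤ i < j ≤ m`, the points `x₁⋯xₖ.P` with `i ≤ k ≤ j` lie in the `R`-neighbourhood of every
geodesic connecting `x₁⋯xᵢ.P` and `x₁⋯xⱼ.P`. -/
def GeodesicWords (A : IsometricAction C X) (P : X) (M : DFA S Q) : Prop :=
  ∃ R : ℝ, 0 ≤ R ∧ ∀ x ∈ M.accepts, ∀ i j : ℕ, i < j → j ≤ x.length →
    ∀ σ : Set X,
      IsGeodesicSegment σ (A.actWord (toArrows (x.take i)) P)
        (A.actWord (toArrows (x.take j)) P) →
      ∀ k : ℕ, i ≤ k → k ≤ j → ∃ q ∈ σ, dist (A.actWord (toArrows (x.take k)) P) q ≤ R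

/-- There are interesting loxodromic actions: there is a loop in the accessible sub-automaton such
that the product of the letters read along this loop acts loxodromically. -/
def InterestingLoxodromic (A : IsometricAction C X) (P : X) (M : DFA S Q) (fail : Q) : Prop :=
  ∃ s ∈ accessible M fail, ∃ x : List S, (∀ y, y <+: x → M.evalFrom s y ∈ accessible M fail) ∧
    M.evalFrom s x = s ∧
    ∃ (a b : C) (f : a ⟶ b), IsProduct (toArrows x) f ∧ IsLoxodromic P (A.act f)

/-- `B(l)`: the elements of `G` whose normal form is of length at most `l`. -/
def normalFormBall {b : C} {G : Submonoid (End b)} (nf : G → List S) (l : ℕ) : Set G :=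
  {g | (nf g).length ≤ l}

end Hypotheses

end NormalForms

/-!
Let `E` be the accepting accessible state at which the paths of the rigid word end. If a word `u`
leads to `E` both from the start state and from `E` itself, then `u ++ v` is rigid for every loop
`v` at `E`. If moreover `u` runs through a high power of the loxodromic loop, then `u ++ v` moves
the base point by more than the constant up to which, by the geodesic words hypothesis, displacement
is superadditive along accepted words. Hence the displacement of its powers grows linearly and it
acts loxodromically.

It remains to see that the words `u ++ v` make up a definite proportion of all accepted words. The
path of an accepted word has a peripheral part before it enters the accessible sub-automaton, which
it then never leaves. Let `aₙ` and `bₙ` count the words readable in the accessible sub-automaton and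
in the periphery. Since `a` is submultiplicative, Fekete's lemma turns its growth rate into a lower
bound valid for every `n`, so the domination hypothesis makes `∑ bₙ / aₙ` converge. Recurrence makes
`a` supermultiplicative up to a constant, so the number of accepted words of length `n` is `O(aₙ)`,
and, again by recurrence, `aₙ` is bounded by a multiple of the number of loops at `E` of length
`n - k`, for each fixed `k`.
-/

namespace NormalForms

open Asymptotics

/-! ### Sequences -/

section Sequences

theorem exp_coe_mul_natCast (x : ℝ) (n : ℕ) :
    EReal.exp ((x : EReal) * n) = ENNReal.ofReal (Real.exp (x * n)) := by
  rw [← EReal.coe_natCast, ← EReal.coe_mul, EReal.exp_coe]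

/-- A submultiplicative sequence whose logarithm is once below a line through the origin stays below
a line of the same slope from some point on, so one exceptional `n` would bound the growth. -/
theorem exp_mul_le_of_lt_expGrowthSup {a : ℕ → ℝ} (ha : ∀ n, 0 < a n)
    (hsub : ∀ m n, a (m + n) ≤ a m * a n) {y : ℝ}
    (hy : y < ExpGrowth.expGrowthSup fun n => ENNReal.ofReal (a n)) {n : ℕ} (hn : n ≠ 0) :
    Real.exp (y * n) ≤ a n := by
  have hlog : Subadditive fun n => Real.log (a n) := fun m n => by
    rw [← Real.log_mul (ha m).ne' (ha n).ne']
    exact Real.log_le_log (ha _) (hsub m n)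
  by_contra! hlt
  have hslope : Real.log (a n) / n < y := by
    rwa [div_lt_iff₀ (by positivity), Real.log_lt_iff_lt_exp (ha n)]
  obtain ⟨m, hle, hm, hm0⟩ := ((ExpGrowth.frequently_exp_le hy).and_eventually
    ((hlog.eventually_div_lt_of_div_lt hn hslope).and (eventually_gt_atTop 0))).exists
  rw [exp_coe_mul_natCast, ENNReal.ofReal_le_ofReal_iff (ha m).le] at hle
  rw [div_lt_iff₀ (by exact_mod_cast hm0), Real.log_lt_iff_lt_exp (ha m)] at hm
  exact hm.not_ge hle

theorem summable_div_of_expGrowthSup_lt {a b : ℕ → ℝ} (ha : ∀ n, 0 < a n) (hb : ∀ n, 0 ≤ b n)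
    (hsub : ∀ m n, a (m + n) ≤ a m * a n)
    (h : ExpGrowth.expGrowthSup (fun n => ENNReal.ofReal (b n)) <
      ExpGrowth.expGrowthSup fun n => ENNReal.ofReal (a n)) :
    Summable fun n => b n / a n := by
  obtain ⟨x, hbx, hxa⟩ := EReal.lt_iff_exists_real_btwn.1 h
  obtain ⟨y, hxy, hya⟩ := EReal.lt_iff_exists_real_btwn.1 hxa
  have hgeom : Summable fun n : ℕ => Real.exp (x - y) ^ n :=
    summable_geometric_of_lt_one (by positivity)
      (Real.exp_lt_one_iff.2 (sub_neg.2 (EReal.coe_lt_coe_iff.1 hxy)))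
  refine hgeom.of_norm_bounded_eventually_nat ?_
  filter_upwards [ExpGrowth.eventually_le_exp hbx, eventually_ne_atTop 0] with n hbn hn
  rw [exp_coe_mul_natCast, ENNReal.ofReal_le_ofReal_iff (by positivity)] at hbn
  rw [Real.norm_of_nonneg (div_nonneg (hb n) (ha n).le), div_le_iff₀ (ha n)]
  calc b n ≤ Real.exp (x * n) := hbn
    _ = Real.exp (x - y) ^ n * Real.exp (y * n) := by
      rw [← Real.exp_nat_mul, ← Real.exp_add]; ring_nf
    _ ≤ Real.exp (x - y) ^ n * a n := by
      gcongr; exact exp_mul_le_of_lt_expGrowthSup ha hsub hya hn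

theorem isBigO_of_le_add_sum_of_summable {a b w : ℕ → ℝ} {A κ : ℝ} (ha : ∀ n, 0 < a n)
    (hb : ∀ n, 0 ≤ b n) (hw : ∀ n, 0 ≤ w n) (hκ : 0 ≤ κ) (hA : 0 ≤ A)
    (hmul : ∀ i j, a i * a j ≤ A * a (i + j + 1)) (hsum : Summable fun n => b n / a n)
    (h : ∀ n, w n ≤ a n + b n + ∑ i ∈ Finset.range n, b i * (κ * a (n - 1 - i))) :
    w =O[atTop] a := by
  have hd : ∀ n, 0 ≤ b n / a n := fun n => div_nonneg (hb n) (ha n).le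
  have hb_eq : ∀ n, b n = b n / a n * a n := fun n => (div_mul_cancel₀ _ (ha n).ne').symm
  set s := ∑' n, b n / a n
  have hterm : ∀ n, ∀ i ∈ Finset.range n,
      b i * (κ * a (n - 1 - i)) ≤ b i / a i * (κ * (A * a n)) := by
    intro n i hi
    have hin : i + (n - 1 - i) + 1 = n := by have := Finset.mem_range.1 hi; omega
    calc b i * (κ * a (n - 1 - i)) = b i / a i * (κ * (a i * a (n - 1 - i))) := by
          rw [hb_eq i]; field_simp
      _ ≤ b i / a i * (κ * (A * a n)) := by
        refine mul_le_mul_of_nonneg_left (mul_le_mul_of_nonneg_left ?_ hκ) (hd i)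
        exact (hmul _ _).trans_eq (by rw [hin])
  refine .of_bound (1 + s + s * (κ * A)) (Eventually.of_forall fun n => ?_)
  rw [Real.norm_of_nonneg (hw n), Real.norm_of_nonneg (ha n).le]
  have := (ha n).le
  calc w n ≤ a n + b n + ∑ i ∈ Finset.range n, b i * (κ * a (n - 1 - i)) := h n
    _ ≤ a n + s * a n + s * (κ * (A * a n)) := by
      gcongr
      · rw [hb_eq n]
        gcongr
        exact hsum.le_tsum n fun i _ => hd i
      · refine (Finset.sum_le_sum (hterm n)).trans ?_
        rw [← Finset.sum_mul]
        gcongr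
        exact hsum.sum_le_tsum _ fun i _ => hd i
    _ = (1 + s + s * (κ * A)) * a n := by ring

theorem isBigO_sum_range {E : Type*} [SeminormedAddCommGroup E] {f : ℕ → E} {g : ℕ → ℝ}
    (h : f =O[atTop] g) (hg : ∀ n, 0 ≤ g n) (hpos : ∃ n, 0 < g n) :
    (fun n => ∑ i ∈ Finset.range n, f i) =O[atTop] fun n => ∑ i ∈ Finset.range n, g i := by
  obtain ⟨c, hc⟩ := h.bound
  obtain ⟨K, hK⟩ := eventually_atTop.1 hc
  obtain ⟨m, hm⟩ := hpos
  have hhead : (fun _ : ℕ => ∑ i ∈ Finset.range K, f i) =O[atTop]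
      fun n => ∑ i ∈ Finset.range n, g i := by
    refine (isBigO_const_const _ hm.ne' _).trans (.of_bound' ?_)
    filter_upwards [eventually_gt_atTop m] with n hn
    rw [Real.norm_of_nonneg (hg m), Real.norm_of_nonneg (Finset.sum_nonneg fun i _ => hg i)]
    exact Finset.single_le_sum (fun i _ => hg i) (Finset.mem_range.2 hn)
  have htail : (fun n => ∑ i ∈ Finset.Ico K n, f i) =O[atTop]
      fun n => ∑ i ∈ Finset.range n, g i := by
    refine .of_bound |c| (Eventually.of_forall fun n => (norm_sum_le_of_le _ fun i hi =>
      hK i (Finset.mem_Ico.1 hi).1).trans ?_)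
    rw [← Finset.mul_sum, Real.norm_of_nonneg (Finset.sum_nonneg fun i _ => hg i)]
    simp only [Real.norm_of_nonneg (hg _)]
    refine mul_le_mul (le_abs_self c) (Finset.sum_le_sum_of_subset_of_nonneg ?_ fun i _ _ => hg i)
      (Finset.sum_nonneg fun i _ => hg i) (abs_nonneg c)
    exact fun i hi => Finset.mem_range.2 (Finset.mem_Ico.1 hi).2
  refine (hhead.add htail).congr' ?_ .rfl
  filter_upwards [eventually_ge_atTop K] with n hn
  exact Finset.sum_range_add_sum_Ico f hn

theorem liminf_div_pos_of_isBigO {ι : Type*} {l : Filter ι} [l.NeBot] {f g : ι → ℝ}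
    (hf : ∀ᶠ i in l, 0 ≤ f i) (hg : ∀ᶠ i in l, 0 < g i) (hfg : ∀ᶠ i in l, f i ≤ g i)
    (h : g =O[l] f) : 0 < liminf (fun i => f i / g i) l := by
  obtain ⟨c, hc, hgf⟩ := h.exists_pos
  have hbdd : IsBoundedUnder (· ≤ ·) l fun i => f i / g i := by
    refine isBoundedUnder_of_eventually_le (a := 1) ?_
    filter_upwards [hg, hfg] with i hgi hfgi
    exact div_le_one_of_le₀ hfgi hgi.le
  refine (inv_pos.2 hc).trans_le (le_liminf_of_le hbdd.isCoboundedUnder_ge ?_)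
  filter_upwards [hf, hg, hgf.bound] with i hfi hgi hi
  rw [Real.norm_of_nonneg hgi.le, Real.norm_of_nonneg hfi] at hi
  rwa [le_div_iff₀ hgi, inv_mul_le_iff₀ hc]

end Sequences

/-! ### Paths in automata -/

section Automata

variable {α : Type u} {Q : Type v} {M : DFA α Q} {fail : Q} {I T U : Set Q} {s : Q}

/-- The path labelled by the word `x` which starts at `s` runs inside `T`, endpoints included. -/
def StaysIn (M : DFA α Q) (T : Set Q) (s : Q) (x : List α) : Prop :=
  ∀ y, y <+: x → M.evalFrom s y ∈ T

/-- The words of length `n` which label a loop at the state `E`. The intermediate states are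
unrestricted. -/
def loops (M : DFA α Q) (E : Q) (n : ℕ) : Set (List α) :=
  {x | x.length = n ∧ M.evalFrom E x = E}

/-- Any two states of `T` are connected by a path of length exactly `l` inside `T`: the condition
on `l` in `IsRecurrentOn M T`, apart from positivity. -/
def IsRecurrentOfLength (M : DFA α Q) (T : Set Q) (l : ℕ) : Prop :=
  ∀ s ∈ T, ∀ t ∈ T, ∃ x : List α, x.length = l ∧ StaysIn M T s x ∧ M.evalFrom s x = t

/-- A path inside `T` which meets `U` remains in `U` from then on. -/
def IsAbsorbing (M : DFA α Q) (T U : Set Q) : Prop :=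
  ∀ s ∈ U, ∀ c, M.step s c ∈ T → M.step s c ∈ U

theorem staysIn_nil : StaysIn M T s [] ↔ s ∈ T := by
  simp [StaysIn]

theorem staysIn_cons {c : α} {x : List α} :
    StaysIn M T s (c :: x) ↔ s ∈ T ∧ StaysIn M T (M.step s c) x := by
  refine ⟨fun h => ⟨h [] List.nil_prefix, fun y hy => h (c :: y) ?_⟩, fun h y hy => ?_⟩
  · exact List.cons_prefix_cons.2 ⟨rfl, hy⟩
  · rcases List.prefix_cons_iff.1 hy with rfl | ⟨y', rfl, hy'⟩
    · exact h.1
    · exact h.2 y' hy'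

theorem staysIn_append {x y : List α} :
    StaysIn M T s (x ++ y) ↔ StaysIn M T s x ∧ StaysIn M T (M.evalFrom s x) y := by
  induction x generalizing s with
  | nil =>
    exact ⟨fun h => ⟨staysIn_nil.2 (h [] List.nil_prefix), h⟩, And.right⟩
  | cons c x ih => rw [List.cons_append, staysIn_cons, staysIn_cons, ih, and_assoc]; rfl

theorem StaysIn.start_mem {x : List α} (h : StaysIn M T s x) : s ∈ T :=
  h [] List.nil_prefix

theorem StaysIn.evalFrom_mem {x : List α} (h : StaysIn M T s x) : M.evalFrom s x ∈ T :=
  h x List.prefix_rfl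

theorem IsAbsorbing.staysIn (hU : IsAbsorbing M T U) (hs : s ∈ U) {x : List α}
    (h : StaysIn M T s x) : StaysIn M U s x := by
  induction x generalizing s with
  | nil => exact staysIn_nil.2 hs
  | cons c x ih =>
    obtain ⟨-, hx⟩ := staysIn_cons.1 h
    exact staysIn_cons.2 ⟨hs, ih (hU s hs c hx.start_mem) hx⟩

theorem IsAbsorbing.staysIn_or_exists_append_cons (hU : IsAbsorbing M T U) {x : List α}
    (h : StaysIn M T s x) :
    StaysIn M U s x ∨ StaysIn M (T \ U) s x ∨ ∃ (y : List α) (c : α) (z : List α),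
      x = y ++ c :: z ∧ StaysIn M (T \ U) s y ∧ StaysIn M U (M.evalFrom s (y ++ [c])) z := by
  by_cases hs : s ∈ U
  · exact Or.inl (hU.staysIn hs h)
  have hs' : s ∈ T \ U := ⟨h.start_mem, hs⟩
  right
  induction x generalizing s with
  | nil => exact Or.inl (staysIn_nil.2 hs')
  | cons c x ih =>
    obtain ⟨-, hx⟩ := staysIn_cons.1 h
    by_cases hc : M.step s c ∈ U
    · exact Or.inr ⟨[], c, x, rfl, staysIn_nil.2 hs', hU.staysIn hc hx⟩
    rcases ih hx hc ⟨hx.start_mem, hc⟩ with hx | ⟨y, d, z, rfl, hy, hz⟩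
    · exact Or.inl (staysIn_cons.2 ⟨hs', hx⟩)
    · exact Or.inr ⟨c :: y, d, z, rfl, staysIn_cons.2 ⟨hs', hy⟩, hz⟩

theorem IsRecurrentOfLength.exists_staysIn {l : ℕ} (h : IsRecurrentOfLength M T l) (hl : 0 < l)
    (hs : s ∈ T) (n : ℕ) : ∃ x : List α, x.length = n ∧ StaysIn M T s x := by
  induction n generalizing s with
  | zero => exact ⟨[], rfl, staysIn_nil.2 hs⟩
  | succ n ih =>
    obtain ⟨y, hy, hsy, -⟩ := h s hs s hs
    obtain ⟨c, y, rfl⟩ := List.exists_cons_of_length_pos (hy ▸ hl)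
    obtain ⟨x, hx, hsx⟩ := ih (staysIn_cons.1 hsy).2.start_mem
    exact ⟨c :: x, by rw [List.length_cons, hx], staysIn_cons.2 ⟨hs, hsx⟩⟩

theorem isAbsorbing_accessible (M : DFA α Q) (fail : Q) :
    IsAbsorbing M {fail}ᶜ (accessible M fail) := by
  refine fun s hs c hc => ⟨hc, fun t ht => ?_⟩
  obtain ⟨x, hx⟩ := hs.2 t ht
  exact ⟨x ++ [c], by rw [DFA.evalFrom_append_singleton, hx]⟩

theorem IsFSA.evalFrom_fail (h : IsFSA M fail) (x : List α) : M.evalFrom fail x = fail := by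
  induction x with
  | nil => rfl
  | cons c x ih => rw [DFA.evalFrom_cons, h.step_fail, ih]

theorem IsFSA.staysIn_compl_fail (h : IsFSA M fail) {x : List α} (hx : M.evalFrom s x ≠ fail) :
    StaysIn M {fail}ᶜ s x := by
  rintro y ⟨z, rfl⟩ hy
  rw [Set.mem_singleton_iff] at hy
  exact hx (by rw [DFA.evalFrom_of_append, hy, h.evalFrom_fail])

theorem IsFSA.mem_readable_of_mem_accepts (h : IsFSA M fail) {x : List α} (hx : x ∈ M.accepts) :
    x ∈ readable M {M.start} {fail}ᶜ x.length :=
  ⟨rfl, M.start, rfl, h.staysIn_compl_fail (ne_of_mem_of_not_mem hx h.fail_notMem_accept)⟩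

theorem evalFrom_flatten_replicate {x : List α} (h : M.evalFrom s x = s) (n : ℕ) :
    M.evalFrom s (List.replicate n x).flatten = s :=
  M.evalFrom_of_pow h (Language.mem_kstar.2 ⟨_, rfl, fun _ hy => List.eq_of_mem_replicate hy⟩)

/-! ### Counting words -/

theorem ncard_le_ncard_of_subset_image {α β : Type*} {s : Set α} {t : Set β} {f : β → α}
    (h : s ⊆ f '' t) (ht : t.Finite) : s.ncard ≤ t.ncard :=
  (Set.ncard_le_ncard h (ht.image f)).trans (Set.ncard_image_le ht)

variable [Finite α]

theorem finite_readable (I T : Set Q) (n : ℕ) : (readable M I T n).Finite :=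
  (List.finite_length_eq α n).subset fun _ h => h.1

theorem finite_loops (E : Q) (n : ℕ) : (loops M E n).Finite :=
  (List.finite_length_eq α n).subset fun _ h => h.1

theorem growthRate_eq_expGrowthSup_ncard (M : DFA α Q) (I T : Set Q) :
    growthRate M I T =
      ExpGrowth.expGrowthSup fun n => ENNReal.ofReal ((readable M I T n).ncard : ℝ) := by
  simp only [growthRate, ← (finite_readable _ _ _).cast_ncard_eq, ENat.toENNReal_coe,
    ENNReal.ofReal_natCast]

theorem ncard_readable_add_le (M : DFA α Q) (I T : Set Q) (m n : ℕ) :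
    (readable M I T (m + n)).ncard ≤ (readable M I T m).ncard * (readable M T T n).ncard := by
  rw [← Set.ncard_prod]
  refine ncard_le_ncard_of_subset_image (f := fun p => p.1 ++ p.2) ?_
    ((finite_readable _ _ _).prod (finite_readable _ _ _))
  rintro x ⟨hx, s, hs, hsx⟩
  rw [← List.take_append_drop m x] at hsx
  obtain ⟨htake, hdrop⟩ := staysIn_append.1 hsx
  exact ⟨(x.take m, x.drop m), ⟨⟨by simp [hx], s, hs, htake⟩,
    by simp [hx], _, hdrop.start_mem, hdrop⟩, List.take_append_drop m x⟩

theorem IsRecurrentOfLength.ncard_readable_mul_le {l : ℕ} (h : IsRecurrentOfLength M T l)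
    (m n : ℕ) :
    (readable M I T m).ncard * (readable M T T n).ncard ≤ (readable M I T (m + l + n)).ncard := by
  rw [← Set.ncard_prod]
  refine ncard_le_ncard_of_subset_image (f := fun x => (x.take m, x.drop (m + l))) ?_
    (finite_readable _ _ _)
  rintro ⟨x, y⟩ ⟨⟨hx, s, hs, hsx⟩, hy, t, ht, hty⟩
  obtain ⟨z, hz, hsz, hzt⟩ := h _ (StaysIn.evalFrom_mem hsx) t ht
  refine ⟨x ++ z ++ y, ⟨by simp [hx, hy, hz, add_assoc], s, hs, ?_⟩, ?_⟩
  · refine staysIn_append.2 ⟨staysIn_append.2 ⟨hsx, hsz⟩, ?_⟩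
    rwa [DFA.evalFrom_of_append, hzt]
  · exact Prod.ext (by simp [← hx]) (List.drop_left' (by simp [hx, hz]))

theorem IsRecurrentOfLength.ncard_readable_le_ncard_loops {l : ℕ} (h : IsRecurrentOfLength M T l)
    {E : Q} (hE : E ∈ T) (n : ℕ) :
    (readable M T T n).ncard ≤ (loops M E (l + n + l)).ncard := by
  refine ncard_le_ncard_of_subset_image (f := fun x => (x.drop l).take n) ?_ (finite_loops _ _)
  rintro x ⟨hx, s, hs, hsx⟩
  obtain ⟨y, hy, -, hys⟩ := h E hE s hs
  obtain ⟨z, hz, -, hzE⟩ := h _ (StaysIn.evalFrom_mem hsx) E hE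
  refine ⟨y ++ x ++ z, ⟨by simp [hx, hy, hz, add_assoc], ?_⟩, ?_⟩
  · rw [DFA.evalFrom_of_append, DFA.evalFrom_of_append, hys, hzE]
  · rw [List.append_assoc]
    exact (congrArg _ (List.drop_left' hy)).trans (List.take_left' hx)

theorem IsRecurrentOfLength.ncard_readable_pos {l : ℕ} (h : IsRecurrentOfLength M T l) (hl : 0 < l)
    (hT : T.Nonempty) (n : ℕ) : 0 < (readable M T T n).ncard := by
  obtain ⟨s, hs⟩ := hT
  obtain ⟨x, hx, hsx⟩ := h.exists_staysIn hl hs n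
  exact (Set.ncard_pos (finite_readable _ _ _)).2 ⟨x, hx, s, hs, hsx⟩

theorem IsAbsorbing.ncard_readable_le (hU : IsAbsorbing M T U) (I : Set Q) (n : ℕ) :
    (readable M I T n).ncard ≤ (readable M U U n).ncard + (readable M I (T \ U) n).ncard +
      ∑ i ∈ Finset.range n, (readable M I (T \ U) i).ncard *
        (Nat.card α * (readable M U U (n - 1 - i)).ncard) := by
  let entering (i : ℕ) : Set (List α × α × List α) :=
    readable M I (T \ U) i ×ˢ Set.univ ×ˢ readable M U U (n - 1 - i)
  let join (p : List α × α × List α) : List α := p.1 ++ p.2.1 :: p.2.2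
  have hfin (i : ℕ) : (entering i).Finite :=
    (finite_readable _ _ _).prod (Set.finite_univ.prod (finite_readable _ _ _))
  have hsub : readable M I T n ⊆ readable M U U n ∪ readable M I (T \ U) n ∪
      ⋃ i ∈ Finset.range n, join '' entering i := by
    rintro x ⟨hx, s, hs, hsx⟩
    rcases hU.staysIn_or_exists_append_cons hsx with h | h | ⟨y, c, z, rfl, hy, hz⟩
    · exact Or.inl (Or.inl ⟨hx, s, h.start_mem, h⟩)
    · exact Or.inl (Or.inr ⟨hx, s, hs, h⟩)
    · rw [List.length_append, List.length_cons] at hx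
      have hlt : y.length < n := by omega
      have hzlen : z.length = n - 1 - y.length := by omega
      exact Or.inr (Set.mem_biUnion (Finset.mem_coe.2 (Finset.mem_range.2 hlt))
        ⟨(y, c, z), ⟨⟨rfl, s, hs, hy⟩, Set.mem_univ c, hzlen, _, hz.start_mem, hz⟩, rfl⟩)
  refine (Set.ncard_le_ncard hsub ?_).trans ((Set.ncard_union_le _ _).trans
    (add_le_add (Set.ncard_union_le _ _) ?_))
  · exact ((finite_readable _ _ _).union (finite_readable _ _ _)).union
      (Set.Finite.biUnion (Finset.finite_toSet _) fun i _ => (hfin i).image join)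
  · refine (Finset.set_ncard_biUnion_le _ _).trans (Finset.sum_le_sum fun i _ => ?_)
    refine (Set.ncard_image_le (hfin i)).trans_eq ?_
    rw [Set.ncard_prod, Set.ncard_prod, Set.ncard_univ]

theorem IsAbsorbing.isBigO_ncard_readable (hU : IsAbsorbing M T U) (hne : U.Nonempty)
    (hrec : IsRecurrentOn M U) (hgrowth : growthRate M I (T \ U) < growthRate M U U) :
    (fun n => ((readable M I T n).ncard : ℝ)) =O[atTop]
      fun n => ((readable M U U n).ncard : ℝ) := by
  obtain ⟨_ | l, hl, h⟩ := hrec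
  · exact absurd hl (lt_irrefl 0)
  replace h : IsRecurrentOfLength M U (l + 1) := h
  have hpos : ∀ n, (0 : ℝ) < (readable M U U n).ncard := fun n =>
    Nat.cast_pos.2 (h.ncard_readable_pos hl hne n)
  have hsub := ncard_readable_add_le M U U
  have hmul : ∀ i j, (readable M U U i).ncard * (readable M U U j).ncard ≤
      (readable M U U l).ncard * (readable M U U (i + j + 1)).ncard := fun i j =>
    (h.ncard_readable_mul_le i j).trans
      ((congrArg (fun n => (readable M U U n).ncard) (by omega)).trans_le (hsub l (i + j + 1)))
  rw [growthRate_eq_expGrowthSup_ncard, growthRate_eq_expGrowthSup_ncard] at hgrowth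
  refine isBigO_of_le_add_sum_of_summable (κ := Nat.card α) (A := (readable M U U l).ncard) hpos
    (fun _ => Nat.cast_nonneg _) (fun _ => Nat.cast_nonneg _) (Nat.cast_nonneg _)
    (Nat.cast_nonneg _) (fun i j => mod_cast hmul i j) ?_ fun n => mod_cast hU.ncard_readable_le I n
  exact summable_div_of_expGrowthSup_lt hpos (fun _ => Nat.cast_nonneg _)
    (fun m n => mod_cast hsub m n) hgrowth

theorem IsRecurrentOn.isBigO_ncard_readable_ncard_loops (hrec : IsRecurrentOn M T) {E : Q}
    (hE : E ∈ T) (k : ℕ) :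
    (fun n => ((readable M T T n).ncard : ℝ)) =O[atTop]
      fun n => ((loops M E (n - k)).ncard : ℝ) := by
  obtain ⟨l, -, h⟩ := hrec
  replace h : IsRecurrentOfLength M T l := h
  refine .of_bound ((readable M T T (k + 2 * l)).ncard : ℝ) ?_
  filter_upwards [eventually_ge_atTop (k + 2 * l)] with n hn
  obtain ⟨m, rfl⟩ := Nat.exists_eq_add_of_le hn
  rw [Real.norm_natCast, Real.norm_natCast, show k + 2 * l + m - k = l + m + l by omega]
  exact_mod_cast (ncard_readable_add_le M T T _ m).trans
    (Nat.mul_le_mul_left _ (h.ncard_readable_le_ncard_loops hE m))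

theorem IsDominated.isBigO_ncard_readable_ncard_loops (h : IsDominated M fail) {E : Q}
    (hE : E ∈ accessible M fail) (k : ℕ) :
    (fun n => ((readable M {M.start} {fail}ᶜ n).ncard : ℝ)) =O[atTop]
      fun n => ((loops M E (n - k)).ncard : ℝ) :=
  ((isAbsorbing_accessible M fail).isBigO_ncard_readable h.nonempty h.recurrent h.growth).trans
    (h.recurrent.isBigO_ncard_readable_ncard_loops hE k)

end Automata

/-! ### Spheres and balls in a language -/

section WordBalls

variable {α : Type u}

/-- The words of length `n` in the language `L`. -/
def wordSphere (L : Set (List α)) (n : ℕ) : Set (List α) := {x ∈ L | x.length = n}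

/-- The words of length at most `n` in the language `L`. -/
def wordBall (L : Set (List α)) (n : ℕ) : Set (List α) := {x ∈ L | x.length ≤ n}

variable [Finite α]

theorem finite_wordSphere (L : Set (List α)) (n : ℕ) : (wordSphere L n).Finite :=
  (List.finite_length_eq α n).subset fun _ h => h.2

theorem finite_wordBall (L : Set (List α)) (n : ℕ) : (wordBall L n).Finite :=
  (List.finite_length_le α n).subset fun _ h => h.2

theorem ncard_wordBall_eq_sum (L : Set (List α)) (n : ℕ) :
    (wordBall L n).ncard = ∑ i ∈ Finset.range (n + 1), (wordSphere L i).ncard := by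
  induction n with
  | zero => simp [wordBall, wordSphere]
  | succ n ih =>
    have hdisj : Disjoint (wordBall L n) (wordSphere L (n + 1)) :=
      Set.disjoint_left.2 fun x h h' => by have := h.2; have := h'.2; omega
    have hunion : wordBall L (n + 1) = wordBall L n ∪ wordSphere L (n + 1) :=
      Set.ext fun x => by simp only [wordBall, wordSphere, Set.mem_union, Set.mem_ofPred_eq]; grind
    rw [Finset.sum_range_succ, ← ih, hunion,
      Set.ncard_union_eq hdisj (finite_wordBall L n) (finite_wordSphere L (n + 1))]

theorem liminf_ncard_wordBall_div_pos {L L' : Set (List α)} (hsub : L' ⊆ L) (hne : L'.Nonempty)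
    (h : (fun n => ((wordSphere L n).ncard : ℝ)) =O[atTop]
      fun n => ((wordSphere L' n).ncard : ℝ)) :
    0 < liminf (fun n => ((wordBall L' n).ncard : ℝ) / (wordBall L n).ncard) atTop := by
  obtain ⟨x, hx⟩ := hne
  have hsphere : 0 < ((wordSphere L' x.length).ncard : ℝ) :=
    Nat.cast_pos.2 ((Set.ncard_pos (finite_wordSphere _ _)).2 ⟨x, hx, rfl⟩)
  refine liminf_div_pos_of_isBigO (Eventually.of_forall fun _ => Nat.cast_nonneg _) ?_
    (Eventually.of_forall fun n => ?_) ?_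
  · filter_upwards [eventually_ge_atTop x.length] with n hn
    exact Nat.cast_pos.2 ((Set.ncard_pos (finite_wordBall _ _)).2 ⟨x, hsub hx, hn⟩)
  · exact Nat.cast_le.2 (Set.ncard_le_ncard (fun y hy => ⟨hsub hy.1, hy.2⟩) (finite_wordBall _ _))
  · simp only [ncard_wordBall_eq_sum, Nat.cast_sum]
    exact (isBigO_sum_range h (fun _ => Nat.cast_nonneg _) ⟨_, hsphere⟩).comp_tendsto
      (tendsto_add_atTop_nat 1)

end WordBalls

/-! ### Displacement of the base point -/

section Displacement

variable {C : Type u} [Category.{v} C] {X : Type w} [MetricSpace X]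

theorem IsProduct.unique {x : List (Arrow C)} {a b : C} {f g : a ⟶ b} (hf : IsProduct x f)
    (hg : IsProduct x g) : f = g := by
  induction hf with
  | nil a => cases hg; rfl
  | cons f₁ f₂ x _ ih =>
    cases hg with
    | cons _ g₂ _ hg₂ => rw [ih hg₂]

namespace IsometricAction

variable (A : IsometricAction C X)

theorem actWord_append (x y : List (Arrow C)) (p : X) :
    A.actWord (x ++ y) p = A.actWord x (A.actWord y p) := by
  induction x with
  | nil => rfl
  | cons f x ih => exact congrArg (A.act f.hom) ih

theorem isometry_actWord (x : List (Arrow C)) : Isometry (A.actWord x) := by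
  induction x with
  | nil => exact isometry_id
  | cons f x ih => exact (A.isometry f.hom).comp ih

variable {S : Finset (Arrow C)}

theorem actWord_toArrows_append (x y : List S) (p : X) :
    A.actWord (toArrows (x ++ y)) p = A.actWord (toArrows x) (A.actWord (toArrows y) p) := by
  rw [toArrows, List.map_append, actWord_append]; rfl

theorem actWord_flatten_replicate (x : List S) (n : ℕ) (p : X) :
    A.actWord (toArrows (List.replicate n x).flatten) p = (A.actWord (toArrows x))^[n] p := by
  induction n with
  | zero => rfl
  | succ n ih =>
    rw [List.replicate_succ, List.flatten_cons, actWord_toArrows_append, ih,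
      Function.iterate_succ_apply']

/-- The distance by which the product of the word `x` moves the base point `P`. -/
def displacement (P : X) (x : List S) : ℝ := dist P (A.actWord (toArrows x) P)

theorem displacement_nonneg (P : X) (x : List S) : 0 ≤ A.displacement P x := dist_nonneg

theorem displacement_eq_dist (P : X) (x y : List S) :
    A.displacement P y =
      dist (A.actWord (toArrows x) P) (A.actWord (toArrows (x ++ y)) P) := by
  rw [A.actWord_toArrows_append, (A.isometry_actWord _).dist_eq, displacement]

end IsometricAction

theorem IsGeodesicSegment.dist_add_dist_eq {σ : Set X} {x y q : X} (h : IsGeodesicSegment σ x y)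
    (hq : q ∈ σ) : dist x q + dist q y = dist x y := by
  obtain ⟨γ, h0, h1, hγ, rfl⟩ := h
  obtain ⟨s, hs, rfl⟩ := hq
  have hxy : (0 : ℝ) ≤ dist x y := dist_nonneg
  have hxs := hγ 0 ⟨le_rfl, hxy⟩ s hs
  have hsy := hγ s hs _ ⟨hxy, le_rfl⟩
  rw [h0, zero_sub, abs_neg, abs_of_nonneg hs.1] at hxs
  rw [h1, abs_sub_comm, abs_of_nonneg (sub_nonneg.2 hs.2)] at hsy
  rw [hxs, hsy, add_sub_cancel]

theorem IsGeodesicSegment.dist_add_dist_le {σ : Set X} {x y p q : X} {R : ℝ}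
    (h : IsGeodesicSegment σ x y) (hq : q ∈ σ) (hpq : dist p q ≤ R) :
    dist x p + dist p y ≤ dist x y + 2 * R := by
  have hxp := dist_triangle_right x p q
  have hpy := dist_triangle p q y
  have := h.dist_add_dist_eq hq
  linarith

theorem IsLoxodromic.exists_lt_dist {P : X} {φ : X → X} (h : IsLoxodromic P φ) (B : ℝ) :
    ∃ n : ℕ, B < dist P (φ^[n] P) := by
  obtain ⟨τ, hτ, h⟩ := h
  have hdist : Tendsto (fun n : ℕ => dist P (φ^[n] P)) atTop atTop := by
    refine (h.pos_mul_atTop hτ tendsto_natCast_atTop_atTop).congr' ?_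
    filter_upwards [eventually_ne_atTop 0] with n hn
    exact div_mul_cancel₀ _ (Nat.cast_ne_zero.2 hn)
  exact (hdist.eventually_gt_atTop B).exists

theorem isLoxodromic_of_mul_le_dist {P : X} {φ : X → X} (hφ : Isometry φ) {c : ℝ} (hc : 0 < c)
    (h : ∀ n : ℕ, n * c ≤ dist P (φ^[n] P)) : IsLoxodromic P φ := by
  have hiter (m : ℕ) : Isometry φ^[m] := by
    induction m with
    | zero => exact isometry_id
    | succ m ih => exact ih.comp hφ
  have hsub : Subadditive fun n => dist P (φ^[n] P) := fun m n =>
    calc dist P (φ^[m + n] P) = dist P (φ^[m] (φ^[n] P)) := by rw [Function.iterate_add_apply]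
      _ ≤ dist P (φ^[m] P) + dist (φ^[m] P) (φ^[m] (φ^[n] P)) := dist_triangle _ _ _
      _ = dist P (φ^[m] P) + dist P (φ^[n] P) := by rw [(hiter m).dist_eq]
  have hlim := hsub.tendsto_lim ⟨0, by rintro _ ⟨n, rfl⟩; positivity⟩
  refine ⟨hsub.lim, hc.trans_le (ge_of_tendsto hlim ?_), hlim⟩
  filter_upwards [eventually_gt_atTop 0] with n hn
  rw [le_div_iff₀ (Nat.cast_pos.2 hn), mul_comm]
  exact h n

end Displacement

/-! ### Coarse superadditivity and rigid words -/

section CoarselySuperadditive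

variable {α : Type u} {f : List α → ℝ} {L : Language α} {R : ℝ}

/-- Up to the error `R`, the function `f` is superadditive along the words of the language `L`. -/
def IsCoarselySuperadditive (f : List α → ℝ) (L : Language α) (R : ℝ) : Prop :=
  ∀ x y z, x ++ y ++ z ∈ L → f x + f y ≤ f (x ++ y) + R

namespace IsCoarselySuperadditive

theorem le_append_append (h : IsCoarselySuperadditive f L R) (hf : ∀ x, 0 ≤ f x) {x y z : List α}
    (hxyz : x ++ y ++ z ∈ L) : f y ≤ f (x ++ y ++ z) + 2 * R := by
  have hxy := h x y z hxyz
  have hxy_z := h (x ++ y) z [] (by rwa [List.append_nil])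
  linarith [hf x, hf z]

theorem mul_le_flatten_replicate (h : IsCoarselySuperadditive f L R) (hf : 0 ≤ f []) {x : List α}
    (hx : ∀ n, 0 < n → (List.replicate n x).flatten ∈ L) (n : ℕ) :
    n * (f x - R) ≤ f (List.replicate n x).flatten := by
  induction n with
  | zero => simpa using hf
  | succ n ih =>
    have hpow : (List.replicate (n + 1) x).flatten = (List.replicate n x).flatten ++ x := by
      simp [List.replicate_succ']
    have hstep := h (List.replicate n x).flatten x []
      (by rw [List.append_nil, ← hpow]; exact hx _ n.succ_pos)
    rw [hpow]
    push_cast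
    linarith

end IsCoarselySuperadditive

end CoarselySuperadditive

section RigidWords

variable {α : Type u} {Q : Type v} {M : DFA α Q} {fail E : Q}

theorem IsRigidWord.mem_accepts {x : List α} (h : IsRigidWord M x) : x ∈ M.accepts := by
  simpa using h 1 one_pos

theorem isRigidWord_of_eval {x : List α} (hE : E ∈ M.accept) (h₁ : M.eval x = E)
    (h₂ : M.evalFrom E x = E) : IsRigidWord M x := by
  intro n hn
  obtain ⟨m, rfl⟩ := Nat.exists_eq_succ_of_ne_zero hn.ne'
  rw [DFA.mem_accepts, List.replicate_succ, List.flatten_cons, DFA.eval, DFA.evalFrom_of_append,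
    ← DFA.eval, h₁, evalFrom_flatten_replicate h₂]
  exact hE

theorem exists_append_isRigidWord (hE : E ∈ M.accept) (hE' : E ∈ accessible M fail) {r : List α}
    (hr : M.eval r = E) (hrr : M.eval (r ++ r) = E) {s : Q} (hs : s ∈ accessible M fail)
    {z : List α} (hz : M.evalFrom s z = s) :
    ∃ x y : List α, ∀ v, M.evalFrom E v = E → IsRigidWord M (x ++ z ++ y ++ v) := by
  obtain ⟨x, hx⟩ := hs.2 E hE'.1
  obtain ⟨y, hy⟩ := hE'.2 s hs.1
  have hEr : M.evalFrom E r = E := by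
    rwa [DFA.eval, DFA.evalFrom_of_append, ← DFA.eval, hr] at hrr
  refine ⟨r ++ x, y, fun v hv => isRigidWord_of_eval hE ?_ ?_⟩
  · simp only [DFA.eval, DFA.evalFrom_of_append]
    rw [← DFA.eval, hr, hx, hz, hy, hv]
  · simp only [DFA.evalFrom_of_append, hEr, hx, hz, hy, hv]

end RigidWords

section RigidLoxodromic

variable {C : Type u} [Category.{v} C] {X : Type*} [MetricSpace X] {A : IsometricAction C X}
  {S : Finset (Arrow C)} {Q : Type w} {M : DFA S Q} {fail E : Q} {P : X}

/-- The rigid words over `S` whose product acts loxodromically. -/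
def rigidLoxodromicWords (A : IsometricAction C X) (P : X) (M : DFA S Q) : Set (List S) :=
  {x | IsRigidWord M x ∧ IsLoxodromic P (A.actWord (toArrows x))}

theorem rigidLoxodromicWords_subset_accepts : rigidLoxodromicWords A P M ⊆ M.accepts :=
  fun _ hx => hx.1.mem_accepts

theorem GeodesicWords.exists_isCoarselySuperadditive (hR : GeodesicWords A P M)
    (hX : ∀ x y : X, ∃ σ : Set X, IsGeodesicSegment σ x y) :
    ∃ R : ℝ, IsCoarselySuperadditive (A.displacement P) M.accepts R := by
  obtain ⟨R, hR0, hR⟩ := hR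
  refine ⟨2 * R, fun x y z h => ?_⟩
  rcases Nat.eq_zero_or_pos (x ++ y).length with h0 | h0
  · obtain ⟨rfl, rfl⟩ := List.append_eq_nil_iff.1 (List.length_eq_zero_iff.1 h0)
    simp [IsometricAction.displacement, toArrows, IsometricAction.actWord, hR0]
  obtain ⟨σ, hσ⟩ := hX P (A.actWord (toArrows (x ++ y)) P)
  obtain ⟨q, hq, hxq⟩ := hR _ h 0 (x ++ y).length h0 (by simp) σ
    (by rwa [List.take_left, List.take_zero]) x.length (Nat.zero_le _) (by simp)
  rw [List.append_assoc, List.take_left] at hxq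
  rw [A.displacement_eq_dist P x y]
  exact hσ.dist_add_dist_le hq hxq

theorem IsRigidWord.isLoxodromic {x : List S} (hx : IsRigidWord M x) {R : ℝ}
    (hR : IsCoarselySuperadditive (A.displacement P) M.accepts R)
    (hd : R < A.displacement P x) : IsLoxodromic P (A.actWord (toArrows x)) := by
  refine isLoxodromic_of_mul_le_dist (A.isometry_actWord _) (sub_pos.2 hd) fun n => ?_
  rw [← A.actWord_flatten_replicate]
  exact hR.mul_le_flatten_replicate (A.displacement_nonneg P _) hx n

theorem InterestingLoxodromic.exists_lt_displacement (hL : InterestingLoxodromic A P M fail)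
    (B : ℝ) : ∃ s ∈ accessible M fail, ∃ z, M.evalFrom s z = s ∧ B < A.displacement P z := by
  obtain ⟨s, hs, x, -, hx, a, b, f, hf, hlox⟩ := hL
  rw [funext (A.act_eq_actWord hf)] at hlox
  obtain ⟨n, hn⟩ := hlox.exists_lt_dist B
  rw [← A.actWord_flatten_replicate] at hn
  exact ⟨s, hs, _, evalFrom_flatten_replicate hx n, hn⟩

theorem InterestingLoxodromic.exists_append_mem_rigidLoxodromicWords
    (hL : InterestingLoxodromic A P M fail) (hR : GeodesicWords A P M)
    (hX : ∀ x y : X, ∃ σ : Set X, IsGeodesicSegment σ x y) (hE : E ∈ M.accept)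
    (hE' : E ∈ accessible M fail) {r : List S} (hr : M.eval r = E) (hrr : M.eval (r ++ r) = E) :
    ∃ u : List S, ∀ v, M.evalFrom E v = E → u ++ v ∈ rigidLoxodromicWords A P M := by
  obtain ⟨R, hR⟩ := hR.exists_isCoarselySuperadditive hX
  obtain ⟨s, hs, z, hz, hd⟩ := hL.exists_lt_displacement (3 * R)
  obtain ⟨x, y, hrigid⟩ := exists_append_isRigidWord hE hE' hr hrr hs hz
  refine ⟨x ++ z ++ y, fun v hv => ⟨hrigid v hv, (hrigid v hv).isLoxodromic hR ?_⟩⟩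
  have hacc : x ++ z ++ (y ++ v) ∈ M.accepts := by
    rw [← List.append_assoc]
    exact (hrigid v hv).mem_accepts
  have := hR.le_append_append (A.displacement_nonneg P) hacc
  rw [← List.append_assoc] at this
  linarith

theorem isBigO_ncard_wordSphere_accepts (hM : IsFSA M fail) (hD : IsDominated M fail)
    (hE : E ∈ accessible M fail) {L : Set (List S)} {u : List S}
    (hu : ∀ v, M.evalFrom E v = E → u ++ v ∈ L) :
    (fun n => ((wordSphere M.accepts n).ncard : ℝ)) =O[atTop]
      fun n => ((wordSphere L n).ncard : ℝ) := by
  refine .trans (.of_bound' (Eventually.of_forall fun n => ?_))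
    ((hD.isBigO_ncard_readable_ncard_loops hE u.length).trans (.of_bound' ?_))
  · rw [Real.norm_natCast, Real.norm_natCast, Nat.cast_le]
    refine Set.ncard_le_ncard ?_ (finite_readable _ _ _)
    rintro x ⟨hx, rfl⟩
    exact hM.mem_readable_of_mem_accepts hx
  · filter_upwards [eventually_ge_atTop u.length] with n hn
    rw [Real.norm_natCast, Real.norm_natCast, Nat.cast_le]
    refine Set.ncard_le_ncard_of_injOn (u ++ ·) (fun v hv => ⟨hu v hv.2, ?_⟩)
      (List.append_right_injective u).injOn (finite_wordSphere _ _)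
    rw [List.length_append, hv.1, Nat.add_sub_cancel' hn]

end RigidLoxodromic

section AutomaticNormalForm

variable {C : Type u} [Category.{v} C] {b : C} {G : Submonoid (End b)} {S : Finset (Arrow C)}
  {nf : G → List S} {Q : Type w} {M : DFA S Q} {fail : Q}

namespace AutomaticNormalForm

theorem injective (hG : AutomaticNormalForm G nf M fail) : Function.Injective nf := by
  intro g g' h
  have h' := hG.represents g'
  rw [← h] at h'
  exact Subtype.ext ((hG.represents g).unique h')

theorem range_eq (hG : AutomaticNormalForm G nf M fail) : Set.range nf = M.accepts :=
  Set.ext fun x => (hG.recognized x).symm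

theorem ncard_preimage_wordBall (hG : AutomaticNormalForm G nf M fail) {L : Set (List S)}
    (hL : L ⊆ M.accepts) (l : ℕ) : (nf ⁻¹' wordBall L l).ncard = (wordBall L l).ncard :=
  Set.ncard_preimage_of_injective_subset_range hG.injective
    (hG.range_eq ▸ fun _ hx => hL hx.1)

theorem ncard_normalFormBall (hG : AutomaticNormalForm G nf M fail) (l : ℕ) :
    (normalFormBall nf l).ncard = (wordBall M.accepts l).ncard := by
  rw [← hG.ncard_preimage_wordBall subset_rfl]
  exact congrArg _ (Set.ext fun g => (and_iff_right ((hG.recognized _).2 ⟨g, rfl⟩)).symm)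

theorem ncard_sep_normalFormBall {X : Type*} [MetricSpace X] (A : IsometricAction C X) (P : X)
    (hG : AutomaticNormalForm G nf M fail) (l : ℕ) :
    {g ∈ normalFormBall nf l |
      IsRigidWord M (nf g) ∧ IsLoxodromic P (A.act (toHom g))}.ncard =
      (wordBall (rigidLoxodromicWords A P M) l).ncard := by
  rw [← hG.ncard_preimage_wordBall rigidLoxodromicWords_subset_accepts]
  congr 1 with g
  rw [Set.mem_ofPred_eq, funext (A.act_eq_actWord (hG.represents g))]
  exact and_comm

end AutomaticNormalForm

end AutomaticNormalForm

end NormalForms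

theorem theorem2_general {C : Type*} [Category C] {b : C} (G : Submonoid (End b))
    (S : Finset (Arrow C)) (nf : G → List S) {Q : Type*} (M : DFA S Q) (fail : Q)
    {X : Type*} [MetricSpace X]
    (hX : ∀ x y : X, ∃ σ : Set X, NormalForms.IsGeodesicSegment σ x y) (P : X)
    (A : NormalForms.IsometricAction C X)
    (hG : NormalForms.AutomaticNormalForm G nf M fail)
    (hR : NormalForms.GeodesicWords A P M)
    (hL : NormalForms.InterestingLoxodromic A P M fail) :
    0 < liminf (fun l : ℕ =>
      (({g ∈ NormalForms.normalFormBall nf l | NormalForms.IsRigidWord M (nf g) ∧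
          NormalForms.IsLoxodromic P (A.act (NormalForms.toHom g))}.ncard : ℝ) /
        ((NormalForms.normalFormBall nf l).ncard : ℝ))) atTop := by
  obtain ⟨r, E, hE, hE', hr, hrr⟩ := hG.exists_rigid
  obtain ⟨u, hu⟩ := hL.exists_append_mem_rigidLoxodromicWords hR hX hE hE' hr hrr
  have hsub := NormalForms.rigidLoxodromicWords_subset_accepts (A := A) (P := P) (M := M)
  have hsphere := NormalForms.isBigO_ncard_wordSphere_accepts hG.fsa hG.dominated hE' hu
  simp only [hG.ncard_sep_normalFormBall A P, hG.ncard_normalFormBall]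
  exact NormalForms.liminf_ncard_wordBall_div_pos hsub ⟨_, hu [] rfl⟩ hsphere

/-- Rigid elements which act loxodromically have positive lower density in the balls `B(l)`. -/
theorem theorem2 {C : Type*} [Category C] {b : C} (G : Submonoid (End b))
    (S : Finset (Arrow C)) (nf : G → List S)
    {Q : Type*} [Finite Q] (M : DFA S Q) (fail : Q)
    {X : Type*} [MetricSpace X] (δ : ℝ) (hX : NormalForms.IsHyperbolicGeodesicSpace X δ) (P : X)
    (A : NormalForms.IsometricAction C X)
    (hG : NormalForms.AutomaticNormalForm G nf M fail)
    (hR : NormalForms.GeodesicWords A P M)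
    (hL : NormalForms.InterestingLoxodromic A P M fail) :
    0 < liminf (fun l : ℕ =>
      (({g ∈ NormalForms.normalFormBall nf l | NormalForms.IsRigidWord M (nf g) ∧
          NormalForms.IsLoxodromic P (A.act (NormalForms.toHom g))}.ncard : ℝ) /
        ((NormalForms.normalFormBall nf l).ncard : ℝ))) atTop :=
  theorem2_general G S nf M fail hX.1 P A hG hR hL
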